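/- Let $\mathcal{D} = ([0,1/2]\times[0,1/3]) \cup ([0,1/3]\times[0,1/2])$, and for $k \ge 1$ let $$\mathcal{D}_k = \{(s_1,\dots,s_k,t_1,\dots,t_k)\in[0,1]^{2k} : (s_1+\cdots+s_k,\; t_1+\cdots+t_k)\in\mathcal{D}\}.$$ For a function $f:[0,1]^{2k}\to\mathbb{R}$ and $1\le \ell,\ell'\le k$ put $$I_k(f)=\int_{[0,1]^{2k}} f(s,t)^2\,ds\,dt,\qquad J_k^{(\ell,\ell')}(f)=\int_{[0,1]^{2k}}\left(\int_0^1\!\!\int_0^1 f(s_1,\dots,s_k,t_1,\dots,t_k)\,ds_\ell\,dt_{\ell'}\right)^2 ds\,dt .$$ Call $f$ piecewise continuous if $[0,1]^{2k}$ can be partitioned into finitely many pieces, each with boundary of Lebesgue measure zero, such that the restriction of $f$ to each piece extends continuously to the closure of that piece. Define $$M^2_k(\mathcal{D})=\sup_f \frac{\sum_{\ell=1}^{k}\sum_{\ell'=1}^{k}J_k^{(\ell,\ell')}(f)}{I_k(f)},$$ where the supremum, taken in the extended real line, is over all piecewise continuous $f:[0,1]^{2k}\to\mathbb{R}$ with $I_k(f)>0$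 that vanish outside some closed set $\mathcal{R}\subseteq[0,1]^{2k}$ satisfying $\mathcal{R}+\mathcal{R}=\{x+y : x,y\in\mathcal{R}\}\subseteq\mathcal{D}_k$ (the set $\mathcal{R}$ may depend on $f$). Then $$M^2_{2000}(\mathcal{D})>1 .$$ -/

import Mathlib

open MeasureTheory Set
open scoped Pointwise

/-- The planar region `𝒟 = ([0,1/2] × [0,1/3]) ∪ ([0,1/3] × [0,1/2])`. -/
def regionD : Set (ℝ × ℝ) :=
  (Icc (0 : ℝ) (1 / 2) ×ˢ Icc (0 : ℝ) (1 / 3)) ∪ (Icc (0 : ℝ) (1 / 3) ×ˢ Icc (0 : ℝ) (1 / 2))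

/-- Points `(s, t) = (s₁,…,s_k,t₁,…,t_k)` of `ℝ^{2k} = ℝ^k × ℝ^k`. -/
abbrev Pt (k : ℕ) : Type := (Fin k → ℝ) × (Fin k → ℝ)

/-- The unit cube `[0,1]^{2k}`. -/
def cube (k : ℕ) : Set (Pt k) :=
  {x | (∀ i, x.1 i ∈ Icc (0 : ℝ) 1) ∧ (∀ i, x.2 i ∈ Icc (0 : ℝ) 1)}

/-- `D_k = {(s, t) ∈ [0,1]^{2k} : (s₁+⋯+s_k, t₁+⋯+t_k) ∈ D}`. -/
def liftRegion (k : ℕ) (D : Set (ℝ × ℝ)) : Set (Pt k) :=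
  {x | x ∈ cube k ∧ (∑ i, x.1 i, ∑ i, x.2 i) ∈ D}

/-- `f` is piecewise continuous on the cube: the cube is partitioned into finitely many pieces with
Lebesgue-null boundary (Jordan measurable pieces), and on each piece `f` agrees with a function
that is continuous on the closure of the piece. -/
def IsPiecewiseContinuous (k : ℕ) (f : Pt k → ℝ) : Prop :=
  ∃ (n : ℕ) (P : Fin n → Set (Pt k)),
    (⋃ i, P i) = cube k ∧
    (∀ i j, i ≠ j → Disjoint (P i) (P j)) ∧
    (∀ i, volume (frontier (P i)) = 0) ∧
    ∀ i, ∃ g : Pt k → ℝ, ContinuousOn g (closure (P i)) ∧ EqOn f g (P i)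

/-- The functions over which the supremum is taken. A function on `[0,1]^{2k}` is represented by its
extension by zero to `ℝ^{2k}`; this is part of the requirement that `f` vanishes off `R`. -/
def IsAdmissible (k : ℕ) (D : Set (ℝ × ℝ)) (f : Pt k → ℝ) : Prop :=
  IsPiecewiseContinuous k f ∧
  ∃ R : Set (Pt k), IsClosed R ∧ R ⊆ cube k ∧ R + R ⊆ liftRegion k D ∧
    ∀ x, f x ≠ 0 → x ∈ R

/-- `I_k(f) = ∫_{[0,1]^{2k}} f²`. -/
noncomputable def IInt (k : ℕ) (f : Pt k → ℝ) : ℝ :=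
  ∫ x in cube k, f x ^ 2

/-- `J_k^{(ℓ,ℓ')}(f) = ∫_{[0,1]^{2k}} (∫₀¹ ∫₀¹ f(s, t) ds_ℓ dt_ℓ')² ds dt`. -/
noncomputable def JInt (k : ℕ) (l l' : Fin k) (f : Pt k → ℝ) : ℝ :=
  ∫ x in cube k,
    (∫ v in (0 : ℝ)..1, ∫ u in (0 : ℝ)..1,
      f (Function.update x.1 l u, Function.update x.2 l' v)) ^ 2

/-- `M²_k(D)`, the supremum (in the extended reals) of `(∑_ℓ ∑_ℓ' J_k^{(ℓ,ℓ')}(f)) / I_k(f)` over all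
admissible `f` for which the quotient makes sense. -/
noncomputable def MSq (k : ℕ) (D : Set (ℝ × ℝ)) : EReal :=
  sSup {r : EReal | ∃ f : Pt k → ℝ, IsAdmissible k D f ∧ 0 < IInt k f ∧
    r = (((∑ l : Fin k, ∑ l' : Fin k, JInt k l l' f) / IInt k f : ℝ) : EReal)}

/-! A product f(s,t) = F(s)G(t) suffices, with F supported on ∑ sᵢ ≤ 1/4 and G on ∑ tᵢ ≤ 1/6.
Doubling the support lands in the single rectangle [0,1/2] × [0,1/3], and the quotient factors into
two k-variable quotients. If each is at least C times its size 1/4 or 1/6, with one strict, the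
product exceeds C²/24, so C = 4.9 is enough.

For one factor of size c take ∏ g(βxᵢ) cut off at ∑ xᵢ ≤ c, with β = r/c and g(x) = 1/(1+Ax) on
[0,1]. Let γ = ∫ g, and let Sₙ(r) be the integral of ∏ g(xᵢ)² over ∑ xᵢ ≤ r (`simplexLIntegral`).
Keeping only the points where the other coordinates sum to at most c − 1/β, where the cutoff does
not touch the slice, reduces the claim to C r Sₙ₊₁(r) < (n+1) γ² Sₙ(r−1) for some r.

Such an r is found by averaging both sides against e^{-c₀r} (`exists_simplexLIntegral_lt`). The
weight factors over the coordinates, so all is expressed by m = ∫ g² e^{-c₀x} and m₁ = ∫ x g²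
e^{-c₀x}. When A = c₀(n+1), the identity (1+Ax)g² = g gives m + A m₁ = ∫ g e^{-c₀x} ≤ γ. As γ =
log(1+A)/A, the condition becomes C < log(1+A) e^{-c₀} (`exists_simplexLIntegral_profile_lt`). -/

/-! ### Product integrals and exponential tails -/

open scoped ENNReal in
theorem lintegral_fin_prod_eq_prod {n : ℕ} (f : Fin n → ℝ → ℝ≥0∞) (hf : ∀ i, Measurable (f i)) :
    ∫⁻ x : Fin n → ℝ, ∏ i, f i (x i) = ∏ i, ∫⁻ t, f i t := by
  induction n with
  | zero => simp [lintegral_unique, volume_pi]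
  | succ n ih =>
    have e := volume_preserving_piFinSuccAbove (fun _ : Fin (n + 1) => ℝ) 0
    rw [← e.symm.lintegral_comp_emb (MeasurableEquiv.measurableEmbedding _)]
    simp only [Fin.prod_univ_succ, MeasurableEquiv.piFinSuccAbove_symm_apply, Fin.insertNthEquiv,
      Equiv.coe_fn_mk, Fin.insertNth_zero, Fin.cons_zero, Fin.cons_succ]
    rw [← ih _ fun i => hf i.succ, Measure.volume_eq_prod]
    refine lintegral_prod_mul (μ := volume) (ν := volume) (f := f 0)
      (g := fun x : Fin n → ℝ => ∏ i, f i.succ (x i)) (hf 0).aemeasurable (Measurable.aemeasurable ?_)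
    exact Finset.measurable_prod _ fun i _ => (hf i.succ).comp (measurable_pi_apply i)

theorem lintegral_Ici_exp_neg_mul {c : ℝ} (hc : 0 < c) (s : ℝ) :
    ∫⁻ r in Ici s, ENNReal.ofReal (Real.exp (-c * r)) = ENNReal.ofReal (Real.exp (-c * s) / c) := by
  rw [setLIntegral_congr Ioi_ae_eq_Ici.symm,
    ← ofReal_integral_eq_lintegral_ofReal (exp_neg_integrableOn_Ioi s hc)
      (Filter.Eventually.of_forall fun _ => (Real.exp_pos _).le),
    integral_exp_mul_Ioi (by linarith) s, neg_div_neg_eq]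

theorem lintegral_Ici_mul_exp_neg_mul {c : ℝ} (hc : 0 < c) {s : ℝ} (hs : 0 ≤ s) :
    ∫⁻ r in Ici s, ENNReal.ofReal (r * Real.exp (-c * r)) =
      ENNReal.ofReal ((s + 1 / c) * Real.exp (-c * s) / c) := by
  have hd : ∀ x ∈ Ici s, HasDerivAt (fun r => -((r + 1 / c) * Real.exp (-c * r) / c))
      (x * Real.exp (-c * x)) x := by
    intro x _
    have h1 : HasDerivAt (fun r : ℝ => Real.exp (-c * r)) (Real.exp (-c * x) * (-c * 1)) x :=
      ((hasDerivAt_id x).const_mul (-c)).exp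
    have h2 := ((((hasDerivAt_id x).add_const (1 / c)).mul h1).div_const c).neg
    refine h2.congr_deriv ?_
    simp only [id_eq]
    field_simp
    ring
  have hp : ∀ x ∈ Ioi s, 0 ≤ x * Real.exp (-c * x) := fun x hx =>
    mul_nonneg (hs.trans (le_of_lt hx)) (Real.exp_pos _).le
  have ht : Filter.Tendsto (fun r => -((r + 1 / c) * Real.exp (-c * r) / c)) Filter.atTop
      (nhds 0) := by
    have h1 : Filter.Tendsto (fun r : ℝ => r ^ (1 : ℝ) * Real.exp (-c * r)) Filter.atTop (nhds 0) :=
      tendsto_rpow_mul_exp_neg_mul_atTop_nhds_zero 1 c hc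
    have h2 : Filter.Tendsto (fun r : ℝ => r ^ (0 : ℝ) * Real.exp (-c * r)) Filter.atTop (nhds 0) :=
      tendsto_rpow_mul_exp_neg_mul_atTop_nhds_zero 0 c hc
    simp only [Real.rpow_one, Real.rpow_zero, one_mul] at h1 h2
    have h3 := ((h1.add (h2.const_mul (1 / c))).div_const c).neg
    simp only [mul_zero, add_zero, zero_div, neg_zero] at h3
    refine h3.congr fun r => ?_
    ring
  rw [setLIntegral_congr Ioi_ae_eq_Ici.symm,
    ← ofReal_integral_eq_lintegral_ofReal (integrableOn_Ioi_deriv_of_nonneg' hd hp ht)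
      ((ae_restrict_iff' measurableSet_Ioi).2 (Filter.Eventually.of_forall hp)),
    integral_Ioi_of_hasDerivAt_of_nonneg' hd hp ht, zero_sub, neg_neg]

/-! ### Exponential averages of simplex integrals -/

/-- The integral of the product weight `∏ w(xᵢ)` over the half-space `∑ xᵢ ≤ r`. -/
noncomputable def simplexLIntegral (w : ℝ → ENNReal) (n : ℕ) (r : ℝ) : ENNReal :=
  ∫⁻ x : Fin n → ℝ, (∏ i, w (x i)) * (Ici (∑ i, x i)).indicator 1 r

theorem measurable_prod_apply {n : ℕ} {w : ℝ → ENNReal} (hw : Measurable w) :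
    Measurable fun x : Fin n → ℝ => ∏ i, w (x i) :=
  Finset.measurable_prod _ fun i _ => hw.comp (measurable_pi_apply i)

theorem measurable_halfSpace_indicator (n : ℕ) :
    Measurable fun p : ℝ × (Fin n → ℝ) =>
      (Ici (∑ i, p.2 i)).indicator (1 : ℝ → ENNReal) p.1 := by
  have : (fun p : ℝ × (Fin n → ℝ) => (Ici (∑ i, p.2 i)).indicator (1 : ℝ → ENNReal) p.1) =
      {p : ℝ × (Fin n → ℝ) | ∑ i, p.2 i ≤ p.1}.indicator 1 := by
    ext p; simp [indicator, mem_Ici]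
  rw [this]
  refine measurable_one.indicator (measurableSet_le ?_ measurable_fst)
  fun_prop

/-- Tonelli: for fixed x, the admissible sizes r form the half-line from ∑ xᵢ, so averages over r
become tail integrals of h. -/
theorem lintegral_mul_simplexLIntegral {w : ℝ → ENNReal} (hw : Measurable w) {h : ℝ → ENNReal}
    (hh : Measurable h) (n : ℕ) :
    ∫⁻ r, h r * simplexLIntegral w n r =
      ∫⁻ x : Fin n → ℝ, (∏ i, w (x i)) * ∫⁻ r in Ici (∑ i, x i), h r := by
  have hm := measurable_halfSpace_indicator n
  have hp := measurable_prod_apply (n := n) hw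
  have hm' : Measurable fun p : ℝ × (Fin n → ℝ) =>
      h p.1 * ((∏ i, w (p.2 i)) * (Ici (∑ i, p.2 i)).indicator (1 : ℝ → ENNReal) p.1) :=
    (hh.comp measurable_fst).mul ((hp.comp measurable_snd).mul hm)
  calc ∫⁻ r, h r * simplexLIntegral w n r
      = ∫⁻ r, ∫⁻ x : Fin n → ℝ, h r * ((∏ i, w (x i)) * (Ici (∑ i, x i)).indicator 1 r) := by
        refine lintegral_congr fun r => ?_
        rw [simplexLIntegral, lintegral_const_mul]
        exact hp.mul (hm.comp measurable_prodMk_left)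
    _ = ∫⁻ x : Fin n → ℝ, ∫⁻ r, h r * ((∏ i, w (x i)) * (Ici (∑ i, x i)).indicator 1 r) :=
        lintegral_lintegral_swap hm'.aemeasurable
    _ = _ := by
        refine lintegral_congr fun x => ?_
        rw [← lintegral_indicator measurableSet_Ici, ← lintegral_const_mul _
          (hh.indicator measurableSet_Ici)]
        refine lintegral_congr fun r => ?_
        by_cases hr : r ∈ Ici (∑ i, x i) <;> simp [hr, mul_comm]

theorem simplexLIntegral_eq_zero_of_neg {w : ℝ → ENNReal} (hw0 : ∀ x < 0, w x = 0) (n : ℕ) {r : ℝ}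
    (hr : r < 0) : simplexLIntegral w n r = 0 := by
  refine (lintegral_congr fun x => ?_).trans lintegral_zero
  by_cases hx : ∀ i, 0 ≤ x i
  · have : r ∉ Ici (∑ i, x i) := fun h => by
      have := Finset.sum_nonneg fun i (_ : i ∈ Finset.univ) => hx i
      linarith [mem_Ici.1 h]
    simp [this]
  · push Not at hx
    obtain ⟨i, hi⟩ := hx
    simp [Finset.prod_eq_zero (f := fun i => w (x i)) (Finset.mem_univ i) (hw0 _ hi)]

theorem prod_mul_ofReal_exp_neg {n : ℕ} (w : ℝ → ENNReal) (c : ℝ) (x : Fin n → ℝ) :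
    (∏ i, w (x i)) * ENNReal.ofReal (Real.exp (-c * ∑ i, x i)) =
      ∏ i, w (x i) * ENNReal.ofReal (Real.exp (-c * x i)) := by
  rw [Finset.mul_sum, Real.exp_sum, ENNReal.ofReal_prod_of_nonneg fun i _ => (Real.exp_pos _).le,
    Finset.prod_mul_distrib]

theorem measurable_mul_exp {w : ℝ → ENNReal} (hw : Measurable w) (c : ℝ) :
    Measurable fun x => w x * ENNReal.ofReal (Real.exp (-c * x)) :=
  hw.mul (by fun_prop)

theorem lintegral_exp_mul_simplexLIntegral {w : ℝ → ENNReal} (hw : Measurable w) {c : ℝ}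
    (hc : 0 < c) (n : ℕ) :
    ∫⁻ r, ENNReal.ofReal (Real.exp (-c * r)) * simplexLIntegral w n (r - 1) =
      ENNReal.ofReal (Real.exp (-c) / c) *
        (∫⁻ x, w x * ENNReal.ofReal (Real.exp (-c * x))) ^ n := by
  have key : ∀ x : Fin n → ℝ, (∏ i, w (x i)) * ∫⁻ r in Ici (∑ i, x i),
      ENNReal.ofReal (Real.exp (-c * (r + 1))) = ENNReal.ofReal (Real.exp (-c) / c) *
        ∏ i, w (x i) * ENNReal.ofReal (Real.exp (-c * x i)) := by
    intro x
    have : ∀ r : ℝ, ENNReal.ofReal (Real.exp (-c * (r + 1))) =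
        ENNReal.ofReal (Real.exp (-c)) * ENNReal.ofReal (Real.exp (-c * r)) := fun r => by
      rw [← ENNReal.ofReal_mul (Real.exp_pos _).le, ← Real.exp_add]; ring_nf
    simp_rw [this]
    rw [lintegral_const_mul _ (by fun_prop), lintegral_Ici_exp_neg_mul hc,
      ← prod_mul_ofReal_exp_neg, div_eq_mul_one_div,
      div_eq_mul_one_div (Real.exp (-c)), ENNReal.ofReal_mul (Real.exp_pos _).le,
      ENNReal.ofReal_mul (Real.exp_pos _).le]
    ring
  calc _ = ∫⁻ r, (fun r => ENNReal.ofReal (Real.exp (-c * (r + 1))) *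
          simplexLIntegral w n r) (r - 1) := by simp
    _ = ∫⁻ r, ENNReal.ofReal (Real.exp (-c * (r + 1))) * simplexLIntegral w n r :=
        lintegral_sub_right_eq_self (μ := volume) (fun r =>
          ENNReal.ofReal (Real.exp (-c * (r + 1))) * simplexLIntegral w n r) 1
    _ = _ := by
      rw [lintegral_mul_simplexLIntegral hw (by fun_prop)]
      simp_rw [key]
      rw [lintegral_const_mul _ (measurable_prod_apply (measurable_mul_exp hw c)),
        lintegral_fin_prod_eq_prod _ fun _ => measurable_mul_exp hw c]
      simp

theorem lintegral_prod_mul_coord {n : ℕ} {v u : ℝ → ENNReal} (hv : Measurable v)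
    (hu : Measurable u) (i : Fin (n + 1)) :
    ∫⁻ x : Fin (n + 1) → ℝ, (∏ j, v (x j)) * u (x i) =
      (∫⁻ x, v x * u x) * (∫⁻ x, v x) ^ n := by
  have h : ∀ x : Fin (n + 1) → ℝ, (∏ j, v (x j)) * u (x i) =
      ∏ j, (if j = i then fun t => v t * u t else v) (x j) := by
    intro x
    rw [Fin.prod_univ_succAbove _ i, Fin.prod_univ_succAbove _ i]
    simp [Fin.succAbove_ne]
    ring
  simp_rw [h]
  rw [lintegral_fin_prod_eq_prod, Fin.prod_univ_succAbove _ i]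
  · simp [Fin.succAbove_ne]
  · intro j
    split_ifs
    exacts [hv.mul hu, hv]

/-- The tail integral of r e^{-cr} from s is (s + 1/c) e^{-cs}/c. With s = ∑ xᵢ the exponential
factors, and by symmetry the n+1 summands of s contribute equally. -/
theorem lintegral_mul_exp_mul_simplexLIntegral {w : ℝ → ENNReal} (hw : Measurable w)
    (hw0 : ∀ x < 0, w x = 0) {c : ℝ} (hc : 0 < c) (n : ℕ) :
    ∫⁻ r, ENNReal.ofReal (r * Real.exp (-c * r)) * simplexLIntegral w (n + 1) r =
      ENNReal.ofReal (1 / c) * ((∫⁻ x, w x * ENNReal.ofReal (Real.exp (-c * x))) ^ n *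
        (ENNReal.ofReal (1 / c) * (∫⁻ x, w x * ENNReal.ofReal (Real.exp (-c * x))) +
          (n + 1) * ∫⁻ x, w x * ENNReal.ofReal (Real.exp (-c * x)) * ENNReal.ofReal x)) := by
  have hv := measurable_mul_exp hw c
  set v : ℝ → ENNReal := fun x => w x * ENNReal.ofReal (Real.exp (-c * x)) with hvdef
  have key : ∀ x : Fin (n + 1) → ℝ, (∏ i, w (x i)) * ∫⁻ r in Ici (∑ i, x i),
      ENNReal.ofReal (r * Real.exp (-c * r)) = ENNReal.ofReal (1 / c) *
        ((∏ i, v (x i)) * ENNReal.ofReal (1 / c) +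
          ∑ i, (∏ i, v (x i)) * ENNReal.ofReal (x i)) := by
    intro x
    by_cases hx : ∀ i, 0 ≤ x i
    · have hs : 0 ≤ ∑ i, x i := Finset.sum_nonneg fun i _ => hx i
      rw [lintegral_Ici_mul_exp_neg_mul hc hs, ← Finset.mul_sum, ← mul_add,
        ← ENNReal.ofReal_sum_of_nonneg fun i _ => hx i, ← ENNReal.ofReal_add (by positivity) hs,
        ← prod_mul_ofReal_exp_neg, div_eq_mul_one_div,
        ENNReal.ofReal_mul (by positivity), ENNReal.ofReal_mul (by positivity), add_comm (1 / c)]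
      ring
    · push Not at hx
      obtain ⟨i, hi⟩ := hx
      have h0 : ∏ i, v (x i) = 0 :=
        Finset.prod_eq_zero (Finset.mem_univ i) (by simp [hvdef, hw0 _ hi])
      simp [h0, Finset.prod_eq_zero (f := fun i => w (x i)) (Finset.mem_univ i) (hw0 _ hi)]
  have hp := measurable_prod_apply (n := n + 1) hv
  have hpi : ∀ i : Fin (n + 1), Measurable fun x : Fin (n + 1) → ℝ =>
      (∏ i, v (x i)) * ENNReal.ofReal (x i) := fun i =>
    hp.mul (ENNReal.measurable_ofReal.comp (measurable_pi_apply i))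
  rw [lintegral_mul_simplexLIntegral hw (by fun_prop)]
  simp_rw [key]
  have hsum := Finset.measurable_sum Finset.univ fun i _ => hpi i
  have hall : Measurable fun x : Fin (n + 1) → ℝ => (∏ i, v (x i)) * ENNReal.ofReal (1 / c) +
      ∑ i, (∏ i, v (x i)) * ENNReal.ofReal (x i) := (hp.mul_const _).add hsum
  rw [lintegral_const_mul _ hall,
    lintegral_add_left (hp.mul_const _), lintegral_mul_const _ hp,
    lintegral_fin_prod_eq_prod _ fun _ => hv, lintegral_finsetSum _ fun i _ => hpi i]
  simp_rw [lintegral_prod_mul_coord hv ENNReal.measurable_ofReal]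
  simp only [Finset.prod_const, Finset.sum_const, Finset.card_univ, Fintype.card_fin, nsmul_eq_mul,
    Nat.cast_add, Nat.cast_one]
  ring

/-- Averaging over the size `r` of the simplex against `e^{-cr}`. -/
theorem exists_simplexLIntegral_lt {w : ℝ → ENNReal} (hw : Measurable w)
    (hw0 : ∀ x < 0, w x = 0) {c : ℝ} (hc : 0 < c) (n : ℕ) {a b m : ENNReal}
    (hm : m = ∫⁻ x, w x * ENNReal.ofReal (Real.exp (-c * x))) (hm0 : m ≠ 0) (hmt : m ≠ ⊤)
    (h : b * (ENNReal.ofReal (1 / c) * m +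
        (n + 1) * ∫⁻ x, w x * ENNReal.ofReal (Real.exp (-c * x)) * ENNReal.ofReal x) <
      a * ENNReal.ofReal (Real.exp (-c))) :
    ∃ r > 0, b * (ENNReal.ofReal r * simplexLIntegral w (n + 1) r) <
      a * simplexLIntegral w n (r - 1) := by
  by_contra! hcon
  have hle : ∀ r : ℝ, a * (ENNReal.ofReal (Real.exp (-c * r)) * simplexLIntegral w n (r - 1)) ≤
      b * (ENNReal.ofReal (r * Real.exp (-c * r)) * simplexLIntegral w (n + 1) r) := by
    intro r
    rcases le_or_gt r 0 with hr | hr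
    -- For r ≤ 0 the left side vanishes, so negating the claim for r > 0 alone gives an inequality
    -- on the whole line.
    · simp [simplexLIntegral_eq_zero_of_neg hw0 n (show r - 1 < 0 by linarith)]
    · rw [ENNReal.ofReal_mul hr.le]
      calc _ = ENNReal.ofReal (Real.exp (-c * r)) * (a * simplexLIntegral w n (r - 1)) := by ring
        _ ≤ ENNReal.ofReal (Real.exp (-c * r)) *
            (b * (ENNReal.ofReal r * simplexLIntegral w (n + 1) r)) := mul_le_mul_right (hcon r hr) _
        _ = _ := by ring
  have hmeas : ∀ k, Measurable (simplexLIntegral w k) := fun k =>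
    Measurable.lintegral_prod_right' (f := fun p : ℝ × (Fin k → ℝ) =>
      (∏ i, w (p.2 i)) * (Ici (∑ i, p.2 i)).indicator (1 : ℝ → ENNReal) p.1)
      (((measurable_prod_apply hw).comp measurable_snd).mul (measurable_halfSpace_indicator k))
  have hI := lintegral_mono (μ := volume) hle
  rw [lintegral_const_mul, lintegral_const_mul, lintegral_exp_mul_simplexLIntegral hw hc,
    lintegral_mul_exp_mul_simplexLIntegral hw hw0 hc, ← hm, div_eq_mul_one_div,
    ENNReal.ofReal_mul (Real.exp_pos _).le] at hI
  · refine absurd hI (not_le.2 ?_)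
    have hc' : ENNReal.ofReal (1 / c) ≠ 0 := by
      rw [Ne, ENNReal.ofReal_eq_zero, not_le]; positivity
    -- Both averages share the factor mⁿ/c; it is nonzero and finite, so strictness survives
    -- multiplication by it.
    have hmul := ENNReal.mul_lt_mul_right (mul_ne_zero hc' (pow_ne_zero n hm0))
      (ENNReal.mul_ne_top ENNReal.ofReal_ne_top (ENNReal.pow_ne_top hmt)) h
    convert hmul using 1 <;> ring
  · exact Measurable.mul (by fun_prop) (hmeas _)
  · exact Measurable.mul (by fun_prop) ((hmeas _).comp (measurable_id.sub_const 1))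

/-! ### The profile 1/(1 + Ax) -/

/-- The truncated profile `1 / (1 + A x)` on `[0, 1]`, extended by zero. -/
noncomputable def profile (A : ℝ) : ℝ → ℝ := (Icc (0 : ℝ) 1).indicator fun x => (1 + A * x)⁻¹

theorem profile_of_notMem (A : ℝ) {x : ℝ} (hx : x ∉ Icc (0 : ℝ) 1) : profile A x = 0 :=
  indicator_of_notMem hx _

theorem profile_of_mem (A : ℝ) {x : ℝ} (hx : x ∈ Icc (0 : ℝ) 1) : profile A x = (1 + A * x)⁻¹ :=
  indicator_of_mem hx _

theorem measurable_profile (A : ℝ) : Measurable (profile A) :=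
  Measurable.indicator (by fun_prop) measurableSet_Icc

theorem profile_pos {A : ℝ} (hA : 0 < A) {x : ℝ} (hx : x ∈ Icc (0 : ℝ) 1) : 0 < profile A x := by
  rw [profile_of_mem A hx]
  have := mul_nonneg hA.le hx.1
  positivity

theorem profile_nonneg {A : ℝ} (hA : 0 < A) (x : ℝ) : 0 ≤ profile A x := by
  by_cases hx : x ∈ Icc (0 : ℝ) 1
  · exact (profile_pos hA hx).le
  · rw [profile_of_notMem A hx]

theorem profile_le_one {A : ℝ} (hA : 0 < A) (x : ℝ) : profile A x ≤ 1 := by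
  by_cases hx : x ∈ Icc (0 : ℝ) 1
  · rw [profile_of_mem A hx]
    exact inv_le_one_of_one_le₀ (by linarith [mul_nonneg hA.le hx.1])
  · rw [profile_of_notMem A hx]; exact zero_le_one

theorem integrable_profile {A : ℝ} (hA : 0 < A) : Integrable (profile A) := by
  refine Integrable.mono' (g := (Icc (0 : ℝ) 1).indicator 1) ?_
    (measurable_profile A).aestronglyMeasurable (Filter.Eventually.of_forall fun x => ?_)
  · exact (integrable_indicator_iff measurableSet_Icc).2
      (integrableOn_const (C := (1 : ℝ)) (by simp))
  · rw [Real.norm_of_nonneg (profile_nonneg hA x)]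
    by_cases hx : x ∈ Icc (0 : ℝ) 1
    · simpa [hx] using profile_le_one hA x
    · simp [hx, profile_of_notMem A hx]

theorem integral_profile {A : ℝ} (hA : 0 < A) : ∫ x, profile A x = Real.log (1 + A) / A := by
  rw [profile, integral_indicator measurableSet_Icc, integral_Icc_eq_integral_Ioc,
    ← intervalIntegral.integral_of_le zero_le_one]
  have hpos : ∀ x ∈ uIcc (0 : ℝ) 1, 0 < 1 + A * x := fun x hx => by
    rw [uIcc_of_le zero_le_one] at hx
    linarith [mul_nonneg hA.le hx.1]
  have hd : ∀ x ∈ uIcc (0 : ℝ) 1,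
      HasDerivAt (fun x => Real.log (1 + A * x) / A) ((1 + A * x)⁻¹) x := fun x hx => by
    have h1 : HasDerivAt (fun x : ℝ => 1 + A * x) (A * 1) x :=
      ((hasDerivAt_id x).const_mul A).const_add 1
    refine ((h1.log (hpos x hx).ne').div_const A).congr_deriv ?_
    field_simp
  rw [intervalIntegral.integral_eq_sub_of_hasDerivAt hd]
  · simp
  · exact (ContinuousOn.inv₀ (by fun_prop) fun x hx => (hpos x hx).ne').intervalIntegrable

/-- The size-averaging inequality for the profile `1 / (1 + A x)` with `A = c (n + 1)`. -/
theorem exists_simplexLIntegral_profile_lt {A c C : ℝ} (hA : 0 < A) (hc : 0 < c) (hC : 0 ≤ C) (n : ℕ)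
    (hAc : A = c * (n + 1)) (h : C < Real.log (1 + A) * Real.exp (-c)) :
    ∃ r > 0, ENNReal.ofReal C *
        (ENNReal.ofReal r * simplexLIntegral (fun x => ENNReal.ofReal (profile A x ^ 2)) (n + 1) r) <
      ENNReal.ofReal ((n + 1) * (Real.log (1 + A) / A) ^ 2) *
        simplexLIntegral (fun x => ENNReal.ofReal (profile A x ^ 2)) n (r - 1) := by
  set w : ℝ → ENNReal := fun x => ENNReal.ofReal (profile A x ^ 2) with hwdef
  have hw : Measurable w := ENNReal.measurable_ofReal.comp ((measurable_profile A).pow_const 2)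
  have hw0 : ∀ x < 0, w x = 0 := fun x hx => by
    simp [hwdef, profile_of_notMem A (fun h : x ∈ Icc (0 : ℝ) 1 => (h.1.trans_lt hx).false)]
  have hv := measurable_mul_exp hw c
  have hγ : ENNReal.ofReal (Real.log (1 + A) / A) = ∫⁻ x, ENNReal.ofReal (profile A x) := by
    rw [← integral_profile hA, ofReal_integral_eq_lintegral_ofReal (integrable_profile hA)
      (Filter.Eventually.of_forall (profile_nonneg hA))]
  have hL : 0 < Real.log (1 + A) := Real.log_pos (by linarith)
  have hsum : (∫⁻ x, w x * ENNReal.ofReal (Real.exp (-c * x))) + ENNReal.ofReal A *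
      ∫⁻ x, w x * ENNReal.ofReal (Real.exp (-c * x)) * ENNReal.ofReal x ≤
      ENNReal.ofReal (Real.log (1 + A) / A) := by
    have hvx : Measurable fun x => w x * ENNReal.ofReal (Real.exp (-c * x)) * ENNReal.ofReal x :=
      hv.mul ENNReal.measurable_ofReal
    rw [hγ, ← lintegral_const_mul _ hvx, ← lintegral_add_left hv]
    refine lintegral_mono fun x => ?_
    by_cases hx : x ∈ Icc (0 : ℝ) 1
    · have h1 : 0 < 1 + A * x := by linarith [mul_nonneg hA.le hx.1]
      have h2 : Real.exp (-c * x) ≤ 1 := Real.exp_le_one_iff.2 (by nlinarith [mul_nonneg hc.le hx.1])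
      simp only [hwdef]
      rw [← ENNReal.ofReal_mul (by positivity), ← ENNReal.ofReal_mul (by positivity),
        ← ENNReal.ofReal_mul hA.le, ← ENNReal.ofReal_add (by positivity)
          (by have := hx.1; positivity)]
      refine ENNReal.ofReal_le_ofReal ?_
      rw [profile_of_mem A hx]
      -- The profile is chosen for this cancellation: (1 + Ax) g² = g.
      calc _ = (1 + A * x)⁻¹ * Real.exp (-c * x) := by field_simp
        _ ≤ _ := mul_le_of_le_one_right (by positivity) h2
    · simp [hwdef, profile_of_notMem A hx]
  refine exists_simplexLIntegral_lt hw hw0 hc n rfl ?_ ?_ ?_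
  · rw [Ne, lintegral_eq_zero_iff hv]
    intro h0
    have hne : ∀ x ∈ Icc (0 : ℝ) 1, w x * ENNReal.ofReal (Real.exp (-c * x)) ≠ 0 := fun x hx => by
      have h1 := profile_pos hA hx
      refine mul_ne_zero ?_ ?_ <;> rw [Ne, ENNReal.ofReal_eq_zero, not_le] <;> positivity
    have : volume (Icc (0 : ℝ) 1) ≤ 0 := by
      rw [← ae_iff.1 h0]
      exact measure_mono fun x hx => hne x hx
    simp at this
  · exact ne_top_of_le_ne_top ENNReal.ofReal_ne_top (le_self_add.trans hsum)
  -- Since n + 1 = A/c, the two terms combine into (1/c)(m + A m₁), which `hsum` bounds.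
  · have hc1 : ENNReal.ofReal (1 / c) * ENNReal.ofReal A = (n + 1 : ENNReal) := by
      rw [← ENNReal.ofReal_mul (by positivity), hAc, one_div, inv_mul_cancel_left₀ hc.ne']
      norm_cast
    rw [← hc1, mul_assoc, ← mul_add]
    refine (mul_le_mul_right (mul_le_mul_right hsum _) _).trans_lt ?_
    rw [← ENNReal.ofReal_mul (by positivity), ← ENNReal.ofReal_mul hC,
      ← ENNReal.ofReal_mul (by positivity), ENNReal.ofReal_lt_ofReal_iff (by positivity)]
    calc C * (1 / c * (Real.log (1 + A) / A))
        < Real.log (1 + A) * Real.exp (-c) * (1 / c * (Real.log (1 + A) / A)) := by gcongr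
      _ = _ := by
        have : (n + 1 : ℝ) = A / c := by rw [hAc]; field_simp
        rw [this]; field_simp

/-! ### Numerical bound -/

theorem log_mul_exp_gt : (4.9 : ℝ) < Real.log (1 + 340) * Real.exp (-0.17) := by
  -- From 2^42 ≤ 341^5.
  have h1 : (42 : ℝ) * Real.log 2 ≤ 5 * Real.log (1 + 340) := by
    have := Real.log_le_log (x := 2 ^ 42) (y := (1 + 340 : ℝ) ^ 5) (by norm_num) (by norm_num)
    rwa [Real.log_pow, Real.log_pow, Nat.cast_ofNat, Nat.cast_ofNat] at this
  have h2 : (0.99 : ℝ) ^ 17 ≤ Real.exp (-0.17) := by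
    have := Real.one_sub_le_exp_neg 0.01
    calc (0.99 : ℝ) ^ 17 ≤ Real.exp (-0.01) ^ 17 := by gcongr; linarith
      _ = _ := by rw [← Real.exp_nat_mul]; norm_num
  have h3 := Real.log_two_gt_d9
  have h4 : (5.822 : ℝ) ≤ Real.log (1 + 340) := by
    generalize Real.log (1 + 340) = y at h1 ⊢
    linarith
  calc (4.9 : ℝ) < 5.822 * 0.99 ^ 17 := by norm_num
    _ ≤ _ := by gcongr

/-! ### The test function on a scaled simplex -/

/-- The product `∏ g(β xᵢ)` of scaled profiles, cut off outside the half-space `∑ xᵢ ≤ c`. -/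
noncomputable def simplexFun (A β c : ℝ) (n : ℕ) (x : Fin n → ℝ) : ℝ :=
  {x : Fin n → ℝ | ∑ i, x i ≤ c}.indicator (fun x => ∏ i, profile A (β * x i)) x

/-- The unit box `[0,1]^n`. -/
def unitBox (n : ℕ) : Set (Fin n → ℝ) := {x | ∀ i, x i ∈ Icc (0 : ℝ) 1}

theorem unitBox_eq_pi (n : ℕ) : unitBox n = Set.pi univ fun _ => Icc (0 : ℝ) 1 := by
  ext x; simp only [unitBox, mem_ofPred_eq, mem_pi, mem_univ, true_implies]

theorem measurableSet_unitBox (n : ℕ) : MeasurableSet (unitBox n) := by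
  rw [unitBox_eq_pi]
  exact MeasurableSet.univ_pi fun _ => measurableSet_Icc

theorem volume_unitBox (n : ℕ) : volume (unitBox n) = 1 := by
  rw [unitBox_eq_pi, volume_pi_pi]; simp

theorem cube_eq_prod (n : ℕ) : cube n = unitBox n ×ˢ unitBox n := rfl

theorem measurable_simplexFun (A β c : ℝ) (n : ℕ) : Measurable (simplexFun A β c n) := by
  refine Measurable.indicator ?_ (measurableSet_le (by fun_prop) measurable_const)
  exact Finset.measurable_prod _ fun i _ => (measurable_profile A).comp (by fun_prop)

theorem simplexFun_nonneg {A : ℝ} (hA : 0 < A) (β c : ℝ) (n : ℕ) (x : Fin n → ℝ) :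
    0 ≤ simplexFun A β c n x :=
  indicator_nonneg (fun _ _ => Finset.prod_nonneg fun _ _ => profile_nonneg hA _) x

theorem simplexFun_le_one {A : ℝ} (hA : 0 < A) (β c : ℝ) (n : ℕ) (x : Fin n → ℝ) :
    simplexFun A β c n x ≤ 1 :=
  indicator_apply_le' (fun _ => Finset.prod_le_one (fun _ _ => profile_nonneg hA _)
    fun _ _ => profile_le_one hA _) fun _ => zero_le_one

/-- The simplex `{x : 0 ≤ xᵢ, β xᵢ ≤ 1, ∑ xᵢ ≤ c}` supporting `simplexFun`. -/
def truncatedSimplex (β c : ℝ) (n : ℕ) : Set (Fin n → ℝ) :=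
  {x | (∀ i, β * x i ∈ Icc (0 : ℝ) 1) ∧ ∑ i, x i ≤ c}

theorem simplexFun_of_mem {A β c : ℝ} {n : ℕ} {x : Fin n → ℝ}
    (hx : x ∈ truncatedSimplex β c n) : simplexFun A β c n x = ∏ i, (1 + A * (β * x i))⁻¹ := by
  rw [simplexFun, indicator_of_mem (show x ∈ {x : Fin n → ℝ | ∑ i, x i ≤ c} from hx.2)]
  exact Finset.prod_congr rfl fun i _ => profile_of_mem A (hx.1 i)

theorem simplexFun_of_notMem {A β c : ℝ} {n : ℕ} {x : Fin n → ℝ}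
    (hx : x ∉ truncatedSimplex β c n) : simplexFun A β c n x = 0 := by
  by_cases hs : ∑ i, x i ≤ c
  · have : ∃ i, β * x i ∉ Icc (0 : ℝ) 1 := by
      by_contra! h
      exact hx ⟨h, hs⟩
    obtain ⟨i, hi⟩ := this
    rw [simplexFun, indicator_of_mem (show x ∈ {x : Fin n → ℝ | ∑ i, x i ≤ c} from hs)]
    exact Finset.prod_eq_zero (Finset.mem_univ i) (profile_of_notMem A hi)
  · exact indicator_of_notMem (s := {x : Fin n → ℝ | ∑ i, x i ≤ c}) hs _

theorem truncatedSimplex_nonneg {β c : ℝ} (hβ : 0 < β) {n : ℕ} {x : Fin n → ℝ}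
    (hx : x ∈ truncatedSimplex β c n) (i : Fin n) : 0 ≤ x i :=
  nonneg_of_mul_nonneg_right (hx.1 i).1 hβ

theorem truncatedSimplex_subset_unitBox {β : ℝ} (hβ : 1 ≤ β) (c : ℝ) (n : ℕ) :
    truncatedSimplex β c n ⊆ unitBox n := fun x hx i => by
  have h0 := truncatedSimplex_nonneg (by linarith) hx i
  refine ⟨h0, le_trans ?_ (hx.1 i).2⟩
  exact le_mul_of_one_le_left h0 hβ

theorem simplexFun_eq_comp_smul (A c : ℝ) {β : ℝ} (hβ : 0 < β) (n : ℕ) (x : Fin n → ℝ) :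
    simplexFun A β c n x = simplexFun A 1 (β * c) n (β • x) := by
  have h : β • x ∈ {x : Fin n → ℝ | ∑ i, x i ≤ β * c} ↔ x ∈ {x : Fin n → ℝ | ∑ i, x i ≤ c} := by
    simp only [mem_ofPred_eq, Pi.smul_apply, smul_eq_mul, ← Finset.mul_sum]
    exact mul_le_mul_iff_right₀ hβ
  by_cases hx : x ∈ {x : Fin n → ℝ | ∑ i, x i ≤ c}
  · rw [simplexFun, simplexFun, indicator_of_mem hx, indicator_of_mem (h.2 hx)]
    simp
  · rw [simplexFun, simplexFun, indicator_of_notMem hx, indicator_of_notMem (mt h.1 hx)]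

theorem integral_simplexFun_sq (A c : ℝ) {β : ℝ} (hβ : 0 < β) (n : ℕ) :
    ∫ x, simplexFun A β c n x ^ 2 = (β ^ n)⁻¹ *
      (simplexLIntegral (fun x => ENNReal.ofReal (profile A x ^ 2)) n (β * c)).toReal := by
  simp_rw [simplexFun_eq_comp_smul A c hβ n]
  rw [Measure.integral_comp_smul volume (fun x => simplexFun A 1 (β * c) n x ^ 2) β,
    integral_eq_lintegral_of_nonneg_ae (Filter.Eventually.of_forall fun x => sq_nonneg _)
      ((measurable_simplexFun A 1 (β * c) n).pow_const 2).aestronglyMeasurable,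
    Module.finrank_fintype_fun_eq_card, Fintype.card_fin, abs_of_nonneg (by positivity),
    smul_eq_mul, simplexLIntegral]
  congr 2
  refine lintegral_congr fun x => ?_
  by_cases hx : ∑ i, x i ≤ β * c
  · rw [simplexFun, indicator_of_mem (show x ∈ {x : Fin n → ℝ | ∑ i, x i ≤ β * c} from hx),
      indicator_of_mem (mem_Ici.2 hx), ← Finset.prod_pow,
      ENNReal.ofReal_prod_of_nonneg fun i _ => sq_nonneg _]
    simp
  · rw [simplexFun, indicator_of_notMem (show x ∉ {x : Fin n → ℝ | ∑ i, x i ≤ β * c} from hx),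
      indicator_of_notMem (mt mem_Ici.1 hx)]
    simp

theorem simplexLIntegral_profile_ne_top {A : ℝ} (hA : 0 < A) (n : ℕ) (r : ℝ) :
    simplexLIntegral (fun x => ENNReal.ofReal (profile A x ^ 2)) n r ≠ ⊤ := by
  have hw : Measurable fun x => ENNReal.ofReal (profile A x ^ 2) :=
    ENNReal.measurable_ofReal.comp ((measurable_profile A).pow_const 2)
  have h1 : ∫⁻ x, ENNReal.ofReal (profile A x ^ 2) ≠ ⊤ := by
    refine ne_top_of_le_ne_top (b := ∫⁻ x, ENNReal.ofReal (profile A x)) ?_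
      (lintegral_mono fun x => ENNReal.ofReal_le_ofReal ?_)
    · rw [← ofReal_integral_eq_lintegral_ofReal (integrable_profile hA)
        (Filter.Eventually.of_forall (profile_nonneg hA))]
      exact ENNReal.ofReal_ne_top
    · exact pow_le_of_le_one (profile_nonneg hA x) (profile_le_one hA x) two_ne_zero
  refine ne_top_of_le_ne_top (ENNReal.pow_ne_top (n := n) h1) ?_
  have h2 := lintegral_fin_prod_eq_prod (n := n) (fun _ => fun x => ENNReal.ofReal (profile A x ^ 2))
    fun _ => hw
  rw [Finset.prod_const, Finset.card_univ, Fintype.card_fin] at h2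
  rw [← h2]
  refine lintegral_mono fun x => mul_le_of_le_one_right' ?_
  by_cases hr : r ∈ Ici (∑ i, x i) <;> simp [hr]

theorem simplexLIntegral_profile_ne_zero {A : ℝ} (hA : 0 < A) (n : ℕ) {r : ℝ} (hr : 0 < r) :
    simplexLIntegral (fun x => ENNReal.ofReal (profile A x ^ 2)) (n + 1) r ≠ 0 := by
  have hw : Measurable fun x => ENNReal.ofReal (profile A x ^ 2) :=
    ENNReal.measurable_ofReal.comp ((measurable_profile A).pow_const 2)
  have hm : Measurable fun x : Fin (n + 1) → ℝ => (∏ i, ENNReal.ofReal (profile A (x i) ^ 2)) *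
      (Ici (∑ i, x i)).indicator (1 : ℝ → ENNReal) r := (measurable_prod_apply hw).mul
    ((measurable_halfSpace_indicator (n + 1)).comp measurable_prodMk_left)
  rw [simplexLIntegral, Ne, lintegral_eq_zero_iff hm]
  intro h0
  -- The cube [0, ε]^(n+1) lies in the half-space and in the support of the weight, and has positive
  -- volume.
  set ε : ℝ := min 1 (r / (n + 1)) with hε
  have hε0 : 0 < ε := lt_min one_pos (by positivity)
  have hvol : volume (Set.pi univ fun _ : Fin (n + 1) => Icc (0 : ℝ) ε) ≤ 0 := by
    rw [← ae_iff.1 h0]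
    refine measure_mono fun x hx => mul_ne_zero (Finset.prod_ne_zero_iff.2 fun i _ => ?_) ?_
    · have hi := hx i (mem_univ i)
      have := profile_pos hA (x := x i) ⟨hi.1, hi.2.trans (min_le_left _ _)⟩
      rw [Ne, ENNReal.ofReal_eq_zero, not_le]
      positivity
    · have : ∑ i, x i ≤ r := by
        calc ∑ i, x i ≤ ∑ _i : Fin (n + 1), r / (n + 1) :=
              Finset.sum_le_sum fun i _ => (hx i (mem_univ i)).2.trans (min_le_right _ _)
          _ = r := by
            rw [Finset.sum_const, Finset.card_univ, Fintype.card_fin, nsmul_eq_mul]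
            push_cast
            field_simp
      simp [this]
  rw [volume_pi_pi] at hvol
  simp only [Real.volume_Icc, sub_zero, nonpos_iff_eq_zero, Finset.prod_eq_zero_iff,
    ENNReal.ofReal_eq_zero, not_le.2 hε0, and_false, exists_false] at hvol

theorem integral_profile_comp_mul {A : ℝ} (hA : 0 < A) {β : ℝ} (hβ : 1 ≤ β) :
    ∫ u in (0 : ℝ)..1, profile A (β * u) = Real.log (1 + A) / A / β := by
  have hβ0 : 0 < β := by linarith
  rw [← integral_profile hA, intervalIntegral.integral_of_le zero_le_one,
    ← integral_Icc_eq_integral_Ioc, setIntegral_eq_integral_of_forall_compl_eq_zero,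
    Measure.integral_comp_mul_left, abs_of_pos (by positivity), smul_eq_mul, div_eq_inv_mul]
  intro u hu
  refine profile_of_notMem A fun h => hu ⟨nonneg_of_mul_nonneg_right h.1 hβ0, ?_⟩
  by_contra! h1
  nlinarith [h.2]

/-! ### Lower bounds for slice integrals -/

/-- The inner integral in the coordinate `l`. -/
noncomputable def sliceIntegral {n : ℕ} (F : (Fin n → ℝ) → ℝ) (l : Fin n) (x : Fin n → ℝ) : ℝ :=
  ∫ u in (0 : ℝ)..1, F (Function.update x l u)

theorem measurable_sliceIntegral {n : ℕ} {F : (Fin n → ℝ) → ℝ} (hF : Measurable F) (l : Fin n) :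
    Measurable (sliceIntegral F l) := by
  have hm : Measurable fun p : (Fin n → ℝ) × ℝ => F (Function.update p.1 l p.2) := by
    refine hF.comp (measurable_pi_iff.2 fun i => ?_)
    by_cases h : i = l
    · subst h; simpa using measurable_snd
    · simp only [Function.update_of_ne h]; fun_prop
  have h2 : sliceIntegral F l = fun x => ∫ u in Ioc (0 : ℝ) 1, F (Function.update x l u) := by
    ext x; exact intervalIntegral.integral_of_le zero_le_one
  rw [h2]
  exact (hm.stronglyMeasurable.integral_prod_right).measurable

theorem integrableOn_sliceIntegral_sq {n : ℕ} {F : (Fin n → ℝ) → ℝ} (hF : Measurable F)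
    (h0 : ∀ x, 0 ≤ F x) (h1 : ∀ x, F x ≤ 1) (l : Fin n) :
    IntegrableOn (fun x => sliceIntegral F l x ^ 2) (unitBox n) := by
  refine Measure.integrableOn_of_bounded (M := 1) (by simp [volume_unitBox])
    ((measurable_sliceIntegral hF l).pow_const 2).aestronglyMeasurable
    (Filter.Eventually.of_forall fun x => ?_)
  have h : ‖sliceIntegral F l x‖ ≤ 1 * |1 - 0| :=
    intervalIntegral.norm_integral_le_of_norm_le_const fun u _ => by
      rw [Real.norm_of_nonneg (h0 _)]; exact h1 _
  rw [norm_pow]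
  exact pow_le_one₀ (norm_nonneg _) (by simpa using h)

theorem simplexFun_insertNth (A β c : ℝ) {n : ℕ} (l : Fin (n + 1)) (u : ℝ) {y : Fin n → ℝ}
    (h : β * u ≤ 1 → u + ∑ i, y i ≤ c) :
    simplexFun A β c (n + 1) (l.insertNth u y) =
      profile A (β * u) * ∏ i, profile A (β * y i) := by
  by_cases hu : β * u ≤ 1
  · rw [simplexFun, indicator_of_mem]
    · simp [Fin.prod_univ_succAbove _ l]
    · simpa [Fin.sum_univ_succAbove _ l] using h hu
  · have h0 : profile A (β * u) = 0 := profile_of_notMem A fun h => hu h.2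
    rw [h0, zero_mul]
    refine simplexFun_of_notMem fun hx => hu ?_
    simpa using (hx.1 l).2

/-- The profile vanishes for u > 1/β. If the other coordinates leave room 1/β below c, the cutoff is
inactive and equality holds; otherwise the left side is 0. -/
theorem le_sliceIntegral_simplexFun {A : ℝ} (hA : 0 < A) {β : ℝ} (hβ : 1 ≤ β) (c : ℝ) {n : ℕ}
    (l : Fin (n + 1)) (v : ℝ) (y : Fin n → ℝ) :
    Real.log (1 + A) / A / β * simplexFun A β (c - 1 / β) n y ≤
      sliceIntegral (simplexFun A β c (n + 1)) l (l.insertNth v y) := by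
  have hβ0 : 0 < β := by linarith
  by_cases hy : ∑ i, y i ≤ c - 1 / β
  · refine le_of_eq ?_
    have h : ∀ u, simplexFun A β c (n + 1) (Function.update (l.insertNth v y : Fin (n + 1) → ℝ) l u) =
        profile A (β * u) * ∏ i, profile A (β * y i) := fun u => by
      rw [Fin.update_insertNth]
      refine simplexFun_insertNth A β c l u fun hu => ?_
      have : u ≤ 1 / β := by rwa [le_div_iff₀' hβ0]
      linarith
    rw [sliceIntegral]
    simp_rw [h]
    rw [intervalIntegral.integral_mul_const, integral_profile_comp_mul hA hβ, simplexFun,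
      indicator_of_mem (show y ∈ {x : Fin n → ℝ | ∑ i, x i ≤ c - 1 / β} from hy)]
  · rw [simplexFun, indicator_of_notMem (show y ∉ {x : Fin n → ℝ | ∑ i, x i ≤ c - 1 / β} from hy),
      mul_zero]
    exact intervalIntegral.integral_nonneg zero_le_one fun u _ => simplexFun_nonneg hA _ _ _ _

/-- The slice integral does not depend on coordinate l, so integrating that coordinate over [0,1]
costs a factor 1. -/
theorem le_integral_sliceIntegral_sq {A : ℝ} (hA : 0 < A) {β : ℝ} (hβ : 1 ≤ β) (c : ℝ) {n : ℕ}
    (l : Fin (n + 1)) :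
    (Real.log (1 + A) / A / β) ^ 2 * ∫ y, simplexFun A β (c - 1 / β) n y ^ 2 ≤
      ∫ x in unitBox (n + 1), sliceIntegral (simplexFun A β c (n + 1)) l x ^ 2 := by
  have hL : 0 < Real.log (1 + A) := Real.log_pos (by linarith)
  have hint := integrableOn_sliceIntegral_sq (measurable_simplexFun A β c (n + 1))
    (simplexFun_nonneg hA β c _) (simplexFun_le_one hA β c _) l
  rw [← integrable_indicator_iff (measurableSet_unitBox _)] at hint
  have e := (volume_preserving_piFinSuccAbove (fun _ : Fin (n + 1) => ℝ) l).symm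
  rw [← integral_indicator (measurableSet_unitBox _),
    ← e.integral_comp (MeasurableEquiv.measurableEmbedding _)]
  have hint' := (e.integrable_comp_emb (MeasurableEquiv.measurableEmbedding _)).2 hint
  have hprod := integral_prod_mul (μ := (volume : Measure ℝ))
    (ν := (volume : Measure (Fin n → ℝ))) ((Icc (0 : ℝ) 1).indicator (1 : ℝ → ℝ))
    (fun y => (Real.log (1 + A) / A / β * simplexFun A β (c - 1 / β) n y) ^ 2)
  have hone : ∫ x, (Icc (0 : ℝ) 1).indicator (1 : ℝ → ℝ) x = 1 := by
    rw [integral_indicator_one measurableSet_Icc]; simp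
  rw [hone, one_mul] at hprod
  simp_rw [mul_pow _ (simplexFun _ _ _ _ _)] at hprod
  rw [integral_const_mul] at hprod
  rw [← hprod]
  refine integral_mono_of_nonneg (Filter.Eventually.of_forall fun p => ?_) hint'
    (Filter.Eventually.of_forall fun p => ?_)
  · exact mul_nonneg (indicator_nonneg (fun _ _ => zero_le_one) _) (by positivity)
  · simp only [MeasurableEquiv.piFinSuccAbove_symm_apply, Fin.insertNthEquiv,
      Equiv.coe_fn_mk]
    have hnn : ∀ x : Fin (n + 1) → ℝ, 0 ≤ (unitBox (n + 1)).indicator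
        (fun x => sliceIntegral (simplexFun A β c (n + 1)) l x ^ 2) x := fun x =>
      indicator_nonneg (fun _ _ => sq_nonneg _) x
    by_cases h1 : p.1 ∈ Icc (0 : ℝ) 1
    · by_cases h2 : p.2 ∈ truncatedSimplex β (c - 1 / β) n
      · have hmem : (l.insertNth p.1 p.2 : Fin (n + 1) → ℝ) ∈ unitBox (n + 1) := by
          refine (Fin.forall_iff_succAbove l).2 ⟨by simpa using h1, fun i => ?_⟩
          simpa using truncatedSimplex_subset_unitBox hβ _ _ h2 i
        rw [indicator_of_mem h1, indicator_of_mem hmem, Pi.one_apply, one_mul, ← mul_pow]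
        exact pow_le_pow_left₀ (mul_nonneg (by positivity) (simplexFun_nonneg hA _ _ _ _))
          (le_sliceIntegral_simplexFun hA hβ c l _ _) 2
      · rw [simplexFun_of_notMem h2]
        simpa using hnn _
    · rw [indicator_of_notMem h1, zero_mul]
      exact hnn _

/-- The scaled form of the averaging inequality. -/
theorem exists_sum_sliceIntegral_gt {A c₀ C : ℝ} (hA : 0 < A) (hc₀ : 0 < c₀) (hC : 0 ≤ C) (n : ℕ)
    (hAc : A = c₀ * (n + 1)) (h : C < Real.log (1 + A) * Real.exp (-c₀)) :
    ∃ r : ℝ, 1 ≤ r ∧ ∀ c : ℝ, 0 < c → c ≤ 1 →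
      0 < ∫ x, simplexFun A (r / c) c (n + 1) x ^ 2 ∧
      C * c * ∫ x, simplexFun A (r / c) c (n + 1) x ^ 2 <
        ∑ l, ∫ x in unitBox (n + 1), sliceIntegral (simplexFun A (r / c) c (n + 1)) l x ^ 2 := by
  obtain ⟨r, hr0, hr⟩ := exists_simplexLIntegral_profile_lt hA hc₀ hC n hAc h
  have hw0 : ∀ x < 0, ENNReal.ofReal (profile A x ^ 2) = 0 := fun x hx => by
    simp [profile_of_notMem A (fun h : x ∈ Icc (0 : ℝ) 1 => (h.1.trans_lt hx).false)]
  -- For r < 1 the right side of `hr` would be 0. The bound r ≥ 1 gives β = r/c ≥ 1, which keeps the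
  -- support in the unit box.
  have hr1 : 1 ≤ r := by
    by_contra! hlt
    rw [simplexLIntegral_eq_zero_of_neg hw0 n (by linarith : r - 1 < 0), mul_zero] at hr
    exact not_lt_zero hr
  refine ⟨r, hr1, fun c hc hc1 => ?_⟩
  have hβ : 1 ≤ r / c := by rw [one_le_div hc]; linarith
  have hβ0 : 0 < r / c := by linarith
  have hrc : r / c * c = r := div_mul_cancel₀ r hc.ne'
  -- Removing a slab of width 1/β lowers the rescaled size by exactly 1, whatever c is; one r
  -- therefore serves both sizes.
  have hrc' : r / c * (c - 1 / (r / c)) = r - 1 := by field_simp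
  have hI := integral_simplexFun_sq A c hβ0 (n + 1)
  have hB := integral_simplexFun_sq A (c - 1 / (r / c)) hβ0 n
  rw [hrc] at hI
  rw [hrc'] at hB
  have hle := fun l : Fin (n + 1) => le_integral_sliceIntegral_sq hA hβ c l
  have hreal := (ENNReal.toReal_lt_toReal
    (ENNReal.mul_ne_top ENNReal.ofReal_ne_top (ENNReal.mul_ne_top ENNReal.ofReal_ne_top
      (simplexLIntegral_profile_ne_top hA _ _)))
    (ENNReal.mul_ne_top ENNReal.ofReal_ne_top (simplexLIntegral_profile_ne_top hA _ _))).2 hr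
  rw [ENNReal.toReal_mul, ENNReal.toReal_mul, ENNReal.toReal_mul, ENNReal.toReal_ofReal hC,
    ENNReal.toReal_ofReal hr0.le, ENNReal.toReal_ofReal (by positivity)] at hreal
  have hpos := ENNReal.toReal_pos (simplexLIntegral_profile_ne_zero hA n hr0)
    (simplexLIntegral_profile_ne_top hA _ _)
  refine ⟨by rw [hI]; positivity, lt_of_lt_of_le ?_ (Finset.sum_le_sum fun l _ => hle l)⟩
  rw [Finset.sum_const, Finset.card_univ, Fintype.card_fin, nsmul_eq_mul, hI, hB]
  set I := (simplexLIntegral (fun x => ENNReal.ofReal (profile A x ^ 2)) (n + 1) r).toReal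
  set B := (simplexLIntegral (fun x => ENNReal.ofReal (profile A x ^ 2)) n (r - 1)).toReal
  set β := r / c with hβdef
  have hcβ : c = r / β := by rw [hβdef]; field_simp
  calc C * c * ((β ^ (n + 1))⁻¹ * I) = (C * (r * I)) * ((β ^ n)⁻¹ * (β ^ 2)⁻¹) := by
        rw [hcβ, pow_succ]; field_simp
    _ < ((n + 1) * (Real.log (1 + A) / A) ^ 2 * B) * ((β ^ n)⁻¹ * (β ^ 2)⁻¹) := by gcongr
    _ = _ := by push_cast; field_simp

/-! ### Admissibility -/

theorem convex_truncatedSimplex (β c : ℝ) (n : ℕ) : Convex ℝ (truncatedSimplex β c n) := by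
  intro x hx y hy a b ha hb hab
  refine ⟨fun i => ?_, ?_⟩
  · have := convex_Icc (0 : ℝ) 1 (hx.1 i) (hy.1 i) ha hb hab
    convert this using 1
    simp only [Pi.add_apply, Pi.smul_apply, smul_eq_mul]
    ring
  · have := convex_Iic c (show ∑ i, x i ∈ Iic c from hx.2) (show ∑ i, y i ∈ Iic c from hy.2) ha hb hab
    simpa [Finset.sum_add_distrib, ← Finset.mul_sum] using this

theorem isClosed_truncatedSimplex (β c : ℝ) (n : ℕ) : IsClosed (truncatedSimplex β c n) := by
  have h : truncatedSimplex β c n =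
      (⋂ i, {x : Fin n → ℝ | β * x i ∈ Icc (0 : ℝ) 1}) ∩ {x | ∑ i, x i ≤ c} := by
    ext x; simp [truncatedSimplex]
  rw [h]
  refine (isClosed_iInter fun i => isClosed_Icc.preimage (by fun_prop)).inter
    (isClosed_le (by fun_prop) continuous_const)

/-- Two pieces suffice, Q and its complement in the cube: frontiers of convex sets are null. -/
theorem isPiecewiseContinuous_of_convex {k : ℕ} {f : Pt k → ℝ} {Q : Set (Pt k)} (hQ : Convex ℝ Q)
    (hQc : IsClosed Q) (hQs : Q ⊆ cube k) (hf : ContinuousOn f Q) (hf0 : ∀ x ∉ Q, f x = 0) :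
    IsPiecewiseContinuous k f := by
  have hcube : Convex ℝ (cube k) := by
    rw [cube_eq_prod, unitBox_eq_pi]
    exact (convex_pi fun _ _ => convex_Icc _ _).prod (convex_pi fun _ _ => convex_Icc _ _)
  have : (volume : Measure (Pt k)).IsAddHaarMeasure :=
    Measure.prod.instIsAddHaarMeasure (volume : Measure (Fin k → ℝ)) (volume : Measure (Fin k → ℝ))
  refine ⟨2, ![Q, cube k \ Q], ?_, ?_, ?_, ?_⟩
  · ext x
    simp only [mem_iUnion, Fin.exists_fin_two, Matrix.cons_val_zero, Matrix.cons_val_one, mem_sdiff]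
    by_cases hx : x ∈ Q
    · simp [hx, hQs hx]
    · simp [hx]
  · intro i j hij
    fin_cases i <;> fin_cases j
    · exact absurd rfl hij
    · exact disjoint_sdiff_right
    · exact disjoint_sdiff_left
    · exact absurd rfl hij
  · refine Fin.forall_fin_two.2 ⟨hQ.addHaar_frontier volume, ?_⟩
    refine measure_mono_null (t := frontier (cube k) ∪ frontier Q) ?_
      (measure_union_null (hcube.addHaar_frontier volume) (hQ.addHaar_frontier volume))
    refine (frontier_inter_subset (cube k) Qᶜ).trans (union_subset_union inter_subset_left ?_)
    rw [frontier_compl]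
    exact inter_subset_right
  · refine Fin.forall_fin_two.2 ⟨⟨f, ?_, fun _ _ => rfl⟩, ⟨fun _ => 0, continuousOn_const, ?_⟩⟩
    · simpa [hQc.closure_eq] using hf
    · exact fun x hx => hf0 x hx.2

theorem continuousOn_simplexFun {A : ℝ} (hA : 0 < A) (β c : ℝ) (n : ℕ) :
    ContinuousOn (simplexFun A β c n) (truncatedSimplex β c n) := by
  refine ContinuousOn.congr (f := fun x => ∏ i, (1 + A * (β * x i))⁻¹) ?_ fun x hx =>
    simplexFun_of_mem hx
  refine continuousOn_finsetProd _ fun i _ => ContinuousOn.inv₀ (by fun_prop) fun x hx => ?_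
  have := mul_nonneg hA.le (hx.1 i).1
  linarith

theorem isAdmissible_simplexFun_mul {A β β' : ℝ} (hA : 0 < A) (hβ : 1 ≤ β) (hβ' : 1 ≤ β') (k : ℕ) :
    IsAdmissible k regionD
      (fun x => simplexFun A β (1 / 4) k x.1 * simplexFun A β' (1 / 6) k x.2) := by
  set Q := truncatedSimplex β (1 / 4) k ×ˢ truncatedSimplex β' (1 / 6) k with hQdef
  have hQs : Q ⊆ cube k := by
    rw [cube_eq_prod]
    exact prod_mono (truncatedSimplex_subset_unitBox hβ _ _)
      (truncatedSimplex_subset_unitBox hβ' _ _)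
  have hQc : IsClosed Q := (isClosed_truncatedSimplex _ _ _).prod (isClosed_truncatedSimplex _ _ _)
  have hf0 : ∀ x ∉ Q, simplexFun A β (1 / 4) k x.1 * simplexFun A β' (1 / 6) k x.2 = 0 := by
    intro x hx
    by_cases h1 : x.1 ∈ truncatedSimplex β (1 / 4) k
    · rw [simplexFun_of_notMem (x := x.2) fun h2 => hx ⟨h1, h2⟩, mul_zero]
    · rw [simplexFun_of_notMem h1, zero_mul]
  refine ⟨isPiecewiseContinuous_of_convex
    ((convex_truncatedSimplex _ _ _).prod (convex_truncatedSimplex _ _ _)) hQc hQs ?_ hf0,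
    Q, hQc, hQs, ?_, fun x hx => by_contra fun h => hx (hf0 x h)⟩
  · exact ((continuousOn_simplexFun hA β _ k).comp continuousOn_fst fun x hx => hx.1).mul
      ((continuousOn_simplexFun hA β' _ k).comp continuousOn_snd fun x hx => hx.2)
  · rintro _ ⟨x, hx, y, hy, rfl⟩
    have bound : ∀ {b d : ℝ} (_ : 1 ≤ b) {u v : Fin k → ℝ}, u ∈ truncatedSimplex b d k →
        v ∈ truncatedSimplex b d k → (∀ i, 0 ≤ u i + v i ∧ u i + v i ≤ ∑ i, (u i + v i)) ∧
          0 ≤ ∑ i, (u i + v i) ∧ ∑ i, (u i + v i) ≤ d + d := by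
      intro b d hb u v hu hv
      have h0 : ∀ i, 0 ≤ u i + v i := fun i => add_nonneg
        (truncatedSimplex_nonneg (by linarith) hu i) (truncatedSimplex_nonneg (by linarith) hv i)
      refine ⟨fun i => ⟨h0 i, Finset.single_le_sum (f := fun i => u i + v i) (fun j _ => h0 j)
        (Finset.mem_univ i)⟩, Finset.sum_nonneg fun i _ => h0 i, ?_⟩
      rw [Finset.sum_add_distrib]
      exact add_le_add hu.2 hv.2
    obtain ⟨h1, h1', h1''⟩ := bound hβ hx.1 hy.1
    obtain ⟨h2, h2', h2''⟩ := bound hβ' hx.2 hy.2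
    -- The doubled sizes 1/4 + 1/4 and 1/6 + 1/6 are the sides of the first rectangle; nonnegativity
    -- bounds each coordinate by the total.
    refine ⟨⟨fun i => ⟨(h1 i).1, ?_⟩, fun i => ⟨(h2 i).1, ?_⟩⟩, Or.inl ⟨⟨h1', ?_⟩, ⟨h2', ?_⟩⟩⟩
    · exact (h1 i).2.trans (h1''.trans (by norm_num))
    · exact (h2 i).2.trans (h2''.trans (by norm_num))
    · exact h1''.trans (by norm_num)
    · exact h2''.trans (by norm_num)

/-! ### Factorization and conclusion -/

theorem IInt_mul {k : ℕ} (F G : (Fin k → ℝ) → ℝ) :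
    IInt k (fun x => F x.1 * G x.2) =
      (∫ x in unitBox k, F x ^ 2) * ∫ x in unitBox k, G x ^ 2 := by
  rw [IInt, cube_eq_prod, Measure.volume_eq_prod, ← setIntegral_prod_mul]
  simp_rw [mul_pow]

theorem JInt_mul {k : ℕ} (F G : (Fin k → ℝ) → ℝ) (l l' : Fin k) :
    JInt k l l' (fun x => F x.1 * G x.2) =
      (∫ x in unitBox k, sliceIntegral F l x ^ 2) * ∫ x in unitBox k, sliceIntegral G l' x ^ 2 := by
  rw [JInt, cube_eq_prod, Measure.volume_eq_prod, ← setIntegral_prod_mul]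
  simp_rw [intervalIntegral.integral_mul_const, intervalIntegral.integral_const_mul, mul_pow,
    sliceIntegral]

theorem one_lt_MSq_regionD {A c₀ C : ℝ} (hA : 0 < A) (hc₀ : 0 < c₀) (hC : 0 ≤ C) (n : ℕ)
    (hAc : A = c₀ * (n + 1)) (h : C < Real.log (1 + A) * Real.exp (-c₀)) (hC2 : 24 ≤ C ^ 2) :
    1 < MSq (n + 1) regionD := by
  obtain ⟨r, hr, hgt⟩ := exists_sum_sliceIntegral_gt hA hc₀ hC n hAc h
  obtain ⟨hI, hJ⟩ := hgt (1 / 4) (by norm_num) (by norm_num)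
  obtain ⟨hI', hJ'⟩ := hgt (1 / 6) (by norm_num) (by norm_num)
  have hβ : 1 ≤ r / (1 / 4) := by linarith
  have hβ' : 1 ≤ r / (1 / 6) := by linarith
  have hset : ∀ {β : ℝ} (c : ℝ), 1 ≤ β → ∫ x in unitBox (n + 1), simplexFun A β c (n + 1) x ^ 2 =
      ∫ x, simplexFun A β c (n + 1) x ^ 2 := fun c hβ =>
    setIntegral_eq_integral_of_forall_compl_eq_zero fun x hx => by
      rw [simplexFun_of_notMem (mt (@truncatedSimplex_subset_unitBox _ hβ _ _ x) hx), sq, zero_mul]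
  have hII := IInt_mul (simplexFun A (r / (1 / 4)) (1 / 4) (n + 1))
    (simplexFun A (r / (1 / 6)) (1 / 6) (n + 1))
  rw [hset _ hβ, hset _ hβ'] at hII
  refine lt_of_lt_of_le ?_ (le_sSup ⟨_, isAdmissible_simplexFun_mul hA hβ hβ' (n + 1), ?_, rfl⟩)
  · rw [← EReal.coe_one, EReal.coe_lt_coe_iff, hII, one_lt_div (mul_pos hI hI')]
    simp_rw [JInt_mul]
    rw [← Finset.sum_mul_sum]
    set I := ∫ x, simplexFun A (r / (1 / 4)) (1 / 4) (n + 1) x ^ 2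
    set I' := ∫ x, simplexFun A (r / (1 / 6)) (1 / 6) (n + 1) x ^ 2
    calc I * I' ≤ C ^ 2 / 24 * (I * I') := le_mul_of_one_le_left (by positivity) (by linarith)
      _ = (C * (1 / 4) * I) * (C * (1 / 6) * I') := by ring
      _ < _ := mul_lt_mul'' hJ hJ' (by positivity) (by positivity)
  · rw [hII]; exact mul_pos hI hI'

theorem mainTheorem9 : 1 < MSq 2000 regionD :=
  -- The value 0.17 nearly maximizes log(1 + 2000c₀) e^{-c₀}, and 4.9² = 24.01 just clears 24.
  one_lt_MSq_regionD (A := 340) (c₀ := 0.17) (C := 4.9) (by norm_num) (by norm_num) (by norm_num)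
    1999 (by norm_num) log_mul_exp_gt (by norm_num)
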